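/- Let $\mathcal X$ be a measurable space and $\gamma>0$. A class $\mathcal F\subset[0,1]^{\mathcal X}$ of measurable functions satisfies $\gamma$-uniform convergence if for all $\varepsilon,\delta>0$ there is $m\in\mathbb N$ such that for every probability distribution $q$ on $\mathcal X$ and every $n\ge m$, with probability at least $1-\delta$ over an i.i.d. sample $S=(x_1,\dots,x_n)\sim q^n$, \[ \sup_{f\in\mathcal F}\left|\mathbb E_{x\sim q}[f(x)]-\frac1n\sum_{i=1}^n f(x_i)\right|\le\gamma+\varepsilon \] (that is, the event that this inequality fails has outer $q^n$-probability at most $\delta$). Let $\mathcal F_1,\dots,\mathcal F_k\subset[0,1]^{\mathcal X}$ be classes of measurable functions, each satisfying $\gamma$-uniform convergence, and let $G:[0,1]^k\to[0,1]$ be $1$-Lipschitz with respect to the $\ell_\infty$ metric. Let \[ \mathcal H=G(\mathcal F_1,\dots,\mathcal F_k)=\{\,x\mapsto G(f_1(x),\dots,f_k(x)) : f_i\in\mathcal F_i \text{ for all } i\,\} \] be the aggregated class, and assume the usual measurability convention for it: for every probability distribution $q$ on $\mathcal X$ and every $n$, the function $(S,S')\mapsto\sup_{h\in\mathcal H}\left|\sum_{i=1}^n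 h(x_i)-\sum_{i=1}^n h(x_i')\right|$ on $\mathcal X^n\times\mathcal X^n$ is measurable with respect to the completion of $q^n\times q^n$. (This is automatic, for instance, if all $\mathcal F_i$ are countable.) Then $\mathcal H$ also satisfies $\gamma$-uniform convergence, at the same scale $\gamma$. -/

import Mathlib

open MeasureTheory

/-- `γ`-uniform convergence of a class `F` of real-valued functions on `X`: for all `ε, δ > 0` there
is a sample size `m` such that for every distribution `q` on `X` and every `n ≥ m`, with probability
at least `1 - δ` over an i.i.d. sample `S ∼ qⁿ`, all `f ∈ F` (equivalently, the supremum over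
`f ∈ F`) satisfy `|𝔼_q f - (1/n) ∑ f (S i)| ≤ γ + ε`.  This is written as a bound by `δ` on the
(outer) probability of the complementary event. -/
def UniformConvergenceAt {X : Type*} [MeasurableSpace X] (γ : ℝ) (F : Set (X → ℝ)) : Prop :=
  ∀ ε : ℝ, 0 < ε → ∀ δ : ℝ, 0 < δ → ∃ m : ℕ,
    ∀ q : Measure X, IsProbabilityMeasure q → ∀ n : ℕ, m ≤ n →
      Measure.pi (fun _ : Fin n => q)
        {S : Fin n → X | ∃ f ∈ F, γ + ε < |(∫ x, f x ∂q) - (1 / (n : ℝ)) * ∑ i, f (S i)|}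
        ≤ ENNReal.ofReal δ

/-- The aggregated class `G(F₁, …, F_k)` of all functions `x ↦ G (f₁ x, …, f_k x)`, `f_i ∈ F_i`. -/
def aggregate {X : Type*} {k : ℕ} (G : (Fin k → ℝ) → ℝ) (F : Fin k → Set (X → ℝ)) :
    Set (X → ℝ) :=
  {h | ∃ f : Fin k → X → ℝ, (∀ i, f i ∈ F i) ∧ h = fun x => G (fun i => f i x)}

/-- The usual measurability convention for a possibly uncountable class `H`: for every distribution
`q` and every `n`, the double-sample supremum
`(S, S') ↦ sup_{h ∈ H} |∑ h (S i) - ∑ h (S' i)|` is measurable with respect to the completion of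
`qⁿ × qⁿ` (its superlevel sets are measurable up to null sets). -/
def DoubleSampleMeasurable {X : Type*} [MeasurableSpace X] (H : Set (X → ℝ)) : Prop :=
  ∀ q : Measure X, IsProbabilityMeasure q → ∀ (n : ℕ) (t : ℝ),
    NullMeasurableSet
      {P : (Fin n → X) × (Fin n → X) | ∃ h ∈ H, t < |∑ i, h (P.1 i) - ∑ i, h (P.2 i)|}
      ((Measure.pi (fun _ : Fin n => q)).prod (Measure.pi (fun _ : Fin n => q)))

/-! Uniform convergence at scale `γ` bounds the number of points that a class can shatter with gap
`α > γ`. On the uniform distribution over many shattered points, take one function low on the sample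
and high elsewhere, and another the other way round. Their two deviations together are almost `2 *
α`, yet each is at most about `γ` (`UniformConvergenceAt.exists_card_lt`).

Bounded shattering gives few colours. After quantization, a Sauer count bounds the shattered
patterns polynomially. A halving argument then colours the class on `N` points with `N ^ O(log N)`
colours, each colour having sup-diameter about `γ` on the points
(`exists_coloring_of_shatterCount_lt`, `UniformConvergenceAt.exists_hasColoring`). Such colourings
survive aggregation: the tuple of the colours of the `f i` colours `G(f)`, and the `ℓ_∞`-Lipschitz
bound keeps the diameter (`HasColoring.aggregate`).

Small colourings return uniform convergence at the same scale. After symmetrization each colour is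
replaced by its centre, at distance half the diameter. A difference `h (S i) - h (S' i)` pays this
twice, so the total loss is `γ` and not `2 * γ`. Hoeffding's bound for the centres beats the
quasi-polynomial number of colours. -/

/-! ### Shattered patterns, the halving colouring and a Sauer-type count. -/

section Combinatorics

variable {ι V : Type*}

/-- A partial assignment `p` of pairs of `far` values to coordinates is shattered by `W` if every
choice of one value from each pair is realised by a member of `W`. -/
def ShattersPattern (far : V → V → Prop) (W : Set (ι → V)) (p : ι → Option (V × V)) : Prop :=
  (∀ x u v, p x = some (u, v) → far u v) ∧
    ∀ e : ι → Bool, ∃ f ∈ W, ∀ x u v, p x = some (u, v) → f x = if e x then u else v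

/-- The number of patterns shattered by `W`. -/
noncomputable def shatterCount (far : V → V → Prop) (W : Set (ι → V)) : ℕ :=
  {p | ShattersPattern far W p}.ncard

lemma ShattersPattern.mono {far : V → V → Prop} {W W' : Set (ι → V)} (h : W ⊆ W')
    {p : ι → Option (V × V)} (hp : ShattersPattern far W p) : ShattersPattern far W' p :=
  ⟨hp.1, fun e => (hp.2 e).imp fun _ hf => ⟨h hf.1, hf.2⟩⟩

lemma ShattersPattern.eq_none_of_fiber {far : V → V → Prop} (hfar : ∀ u, ¬ far u u)
    {W : Set (ι → V)} {x : ι} {i : V} {p : ι → Option (V × V)}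
    (hp : ShattersPattern far {f ∈ W | f x = i} p) : p x = none := by
  rcases h : p x with _ | ⟨u, v⟩
  · rfl
  · obtain ⟨f, hf, hf'⟩ := hp.2 (fun _ => true)
    obtain ⟨g, hg, hg'⟩ := hp.2 (fun _ => false)
    have h1 := hf' x u v h
    have h2 := hg' x u v h
    simp only [if_true, Bool.false_eq_true, if_false] at h1 h2
    have hu : u = i := h1 ▸ hf.2
    have hv : v = i := h2 ▸ hg.2
    exact absurd (hp.1 x u v h) (by rw [hu, hv]; exact hfar i)

lemma ShattersPattern.update {far : V → V → Prop} [DecidableEq ι]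
    {W : Set (ι → V)} {x : ι} {i j : V} (hij : far i j) {p : ι → Option (V × V)}
    (hi : ShattersPattern far {f ∈ W | f x = i} p) (hj : ShattersPattern far {f ∈ W | f x = j} p) :
    ShattersPattern far W (Function.update p x (some (i, j))) := by
  refine ⟨fun y u v hy => ?_, fun e => ?_⟩
  · rcases eq_or_ne y x with rfl | hne
    · simp only [Function.update_self, Option.some.injEq, Prod.mk.injEq] at hy
      exact hy.1 ▸ hy.2 ▸ hij
    · rw [Function.update_of_ne hne] at hy
      exact hi.1 y u v hy
  · have key : ∃ f ∈ W, f x = (if e x then i else j) ∧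
        ∀ y u v, p y = some (u, v) → f y = if e y then u else v := by
      cases he : e x
      · obtain ⟨f, hf, h⟩ := hj.2 e
        exact ⟨f, hf.1, by simpa using hf.2, h⟩
      · obtain ⟨f, hf, h⟩ := hi.2 e
        exact ⟨f, hf.1, by simpa using hf.2, h⟩
    obtain ⟨f, hf, hx, h⟩ := key
    refine ⟨f, hf, fun y u v hy => ?_⟩
    rcases eq_or_ne y x with rfl | hne
    · simp only [Function.update_self, Option.some.injEq, Prod.mk.injEq] at hy
      rw [hx, hy.1, hy.2]
    · rw [Function.update_of_ne hne] at hy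
      exact h y u v hy

/-- Inclusion–exclusion: a pattern shattered by either fiber is shattered by `W`. One shattered by
both is counted a second time by adding the pair `(i, j)` at `x`, where patterns shattered by a
fiber are undefined. -/
lemma shatterCount_fiber_add_le [Finite ι] [Finite V] {far : V → V → Prop} (hfar : ∀ u, ¬ far u u)
    (W : Set (ι → V)) (x : ι) {i j : V} (hij : far i j) :
    shatterCount far {f ∈ W | f x = i} + shatterCount far {f ∈ W | f x = j}
      ≤ shatterCount far W := by
  classical
  set A := {p | ShattersPattern far {f ∈ W | f x = i} p} with hA
  set B := {p | ShattersPattern far {f ∈ W | f x = j} p} with hB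
  have hinj : Set.InjOn (fun p : ι → Option (V × V) => Function.update p x (some (i, j)))
      (A ∩ B) := by
    intro p hp p' hp' heq
    funext y
    rcases eq_or_ne y x with rfl | hne
    · rw [hp.1.eq_none_of_fiber hfar, hp'.1.eq_none_of_fiber hfar]
    · simpa [Function.update_of_ne hne] using congrFun heq y
  have hdisj : Disjoint (A ∪ B)
      ((fun p : ι → Option (V × V) => Function.update p x (some (i, j))) '' (A ∩ B)) := by
    rw [Set.disjoint_right]
    rintro _ ⟨p, -, rfl⟩ (h | h)
    · simpa using ShattersPattern.eq_none_of_fiber hfar h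
    · simpa using ShattersPattern.eq_none_of_fiber hfar h
  unfold shatterCount
  rw [← Set.ncard_union_add_ncard_inter, ← hinj.ncard_image,
    ← Set.ncard_union_eq hdisj]
  refine Set.ncard_le_ncard ?_
  rintro p ((hp | hp) | ⟨p, hp, rfl⟩)
  · exact hp.mono (Set.sep_subset _ _)
  · exact hp.mono (Set.sep_subset _ _)
  · exact ShattersPattern.update hij hp.1 hp.2

/-- A class shattering fewer than `2 ^ r` patterns has a colouring with `r`-step transcripts as
colours in which functions of the same colour never take `far` values. -/
lemma exists_coloring_of_shatterCount_lt [Finite ι] [Finite V] {far : V → V → Prop}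
    (hfar : ∀ u, ¬ far u u) (r : ℕ) : ∀ W : Set (ι → V), shatterCount far W < 2 ^ r →
    ∃ c : (ι → V) → (Fin r → Option (ι × V)),
      ∀ f ∈ W, ∀ g ∈ W, c f = c g → ∀ x, ¬ far (f x) (g x) := by
  classical
  induction r with
  | zero =>
    intro W hW
    refine ⟨fun _ => Fin.elim0, fun f hf => ?_⟩
    have h0 : shatterCount far W = 0 := by simpa using hW
    rw [shatterCount, Set.ncard_eq_zero] at h0
    -- The empty pattern is shattered by every nonempty class, so count zero forces `W` to be empty.
    have : (fun _ => none) ∈ {p | ShattersPattern far W p} :=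
      ⟨by simp, fun _ => ⟨f, hf, by simp⟩⟩
    rw [h0] at this
    exact this.elim
  | succ r ih =>
    intro W hW
    -- `Q f z`: the graph of `f` passes through `z`, and fixing this value at least halves the
    -- count.
    let Q : (ι → V) → ι × V → Prop := fun f z =>
      f z.1 = z.2 ∧ 2 * shatterCount far {f ∈ W | f z.1 = z.2} ≤ shatterCount far W
    have hc : ∀ z : ι × V, ∃ c : (ι → V) → (Fin r → Option (ι × V)),
        2 * shatterCount far {f ∈ W | f z.1 = z.2} ≤ shatterCount far W →
        ∀ f ∈ W, ∀ g ∈ W, f z.1 = z.2 → g z.1 = z.2 → c f = c g → ∀ x, ¬ far (f x) (g x) := by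
      intro z
      by_cases hz : 2 * shatterCount far {f ∈ W | f z.1 = z.2} ≤ shatterCount far W
      · obtain ⟨c, hc⟩ := ih {f ∈ W | f z.1 = z.2} (by rw [pow_succ] at hW; omega)
        exact ⟨c, fun _ f hf g hg h1 h2 => hc f ⟨hf, h1⟩ g ⟨hg, h2⟩⟩
      · exact ⟨fun _ _ => none, fun h => absurd h hz⟩
    choose c hc using hc
    -- The transcript records a halving point and then recurses in its fiber; functions without a
    -- halving point all receive the constant `none`.
    refine ⟨fun f => if h : ∃ z, Q f z then Fin.cons (some h.choose) (c h.choose f)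
      else fun _ => none, fun f hf g hg hfg x hx => ?_⟩
    by_cases h1 : ∃ z, Q f z <;> by_cases h2 : ∃ z, Q g z
    · simp only [dif_pos h1, dif_pos h2, Fin.cons_inj, Option.some.injEq] at hfg
      have q1 := h1.choose_spec
      have q2 := h2.choose_spec
      rw [← hfg.1] at q2
      exact hc h1.choose q1.2 f hf g hg q1.1 q2.1 (by rw [hfg.2, hfg.1]) x hx
    · simp only [dif_pos h1, dif_neg h2] at hfg
      simpa using congrFun hfg 0
    · simp only [dif_neg h1, dif_pos h2] at hfg
      simpa using congrFun hfg 0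
    -- Both fibers at `x` hold more than half of the patterns, which superadditivity forbids when `f
    -- x` and `g x` are far.
    · have a1 : ¬ Q f (x, f x) := fun h => h1 ⟨_, h⟩
      have a2 : ¬ Q g (x, g x) := fun h => h2 ⟨_, h⟩
      simp only [Q, true_and, not_le] at a1 a2
      have := shatterCount_fiber_add_le hfar W x hx
      omega

/-- There are at most `(M + 1) ^ d` finite sets of cardinality at most `d` in a type of size `M`. -/
lemma ncard_finset_card_le (α : Type*) [Fintype α] (d : ℕ) :
    {T : Finset α | T.card ≤ d}.ncard ≤ (Fintype.card α + 1) ^ d := by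
  classical
  -- Each small set is the set of values of a partial enumeration by `Fin d`.
  have hsub : {T : Finset α | T.card ≤ d} ⊆
      Set.range fun g : Fin d → Option α => Finset.univ.filter fun a => ∃ i, g i = some a := by
    intro T hT
    obtain ⟨e⟩ := Function.Embedding.nonempty_of_card_le (α := T) (β := Fin d)
      (by simpa using hT)
    refine ⟨fun i => (Function.partialInv e i).map Subtype.val, ?_⟩
    ext a
    simp only [Finset.mem_filter, Finset.mem_univ, true_and, Option.map_eq_some_iff]
    constructor
    · rintro ⟨i, t, -, rfl⟩
      exact t.2
    · intro ha
      exact ⟨e ⟨a, ha⟩, ⟨a, ha⟩, Function.partialInv_left e.injective _, rfl⟩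
  calc {T : Finset α | T.card ≤ d}.ncard ≤ _ := Set.ncard_le_ncard hsub (Set.toFinite _)
    _ ≤ Nat.card (Fin d → Option α) := by
        rw [← Set.image_univ, ← Set.ncard_univ]
        exact Set.ncard_image_le
    _ = _ := by simp

/-- Sauer-type bound: if shattered patterns live on at most `d` coordinates, there are only
polynomially many of them. -/
lemma shatterCount_le [Fintype ι] [Fintype V] {far : V → V → Prop} (W : Set (ι → V)) (d : ℕ)
    (hd : ∀ p, ShattersPattern far W p → {x | p x ≠ none}.ncard ≤ d) :
    shatterCount far W ≤ (Fintype.card ι * Fintype.card V ^ 2 + 1) ^ d := by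
  classical
  have hcard : Fintype.card (ι × V × V) = Fintype.card ι * Fintype.card V ^ 2 := by
    simp [sq]
  rw [← hcard]
  refine le_trans ?_ (ncard_finset_card_le (ι × V × V) d)
  refine Set.ncard_le_ncard_of_injOn
    -- A pattern is encoded by its graph, which has as many elements as its support.
    (fun p => Finset.univ.filter fun z : ι × V × V => p z.1 = some z.2) ?_ ?_
  · intro p hp
    refine le_trans ?_ (hd p hp)
    rw [← Set.ncard_coe_finset]
    refine Set.ncard_le_ncard_of_injOn Prod.fst ?_ ?_
    · intro z hz
      have hz' : p z.1 = some z.2 := by simpa using hz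
      simp [hz']
    · intro z hz w hw h
      have hz' : p z.1 = some z.2 := by simpa using hz
      have hw' : p w.1 = some w.2 := by simpa using hw
      rw [h, hw'] at hz'
      exact Prod.ext h (Option.some.inj hz').symm
  · intro p _ p' _ h
    funext x
    refine Option.ext fun a => ?_
    have := Finset.ext_iff.1 h (x, a)
    simpa using this

end Combinatorics

/-- The negation of uniform convergence on the uniform distribution over a shattered finite family
of points: for every sample, functions that are low on the sample and high elsewhere, or vice versa,
deviate. -/
lemma two_mul_sub_le_of_low_high {ι : Type*} [Fintype ι] [Nonempty ι] {n : ℕ} (hn : 0 < n)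
    {α D : ℝ} (J : Fin n → ι) {a b : ι → ℝ} (hα : 0 ≤ α)
    (hb : ∀ i, b i ≤ a i + 1) (hlow : ∀ i, i ∈ Set.range J → a i + α ≤ b i)
    (hhigh : ∀ i, i ∉ Set.range J → b i + α ≤ a i)
    (ha_dev : |(∑ i, a i) / Fintype.card ι - (1 / (n : ℝ)) * ∑ t, a (J t)| ≤ D)
    (hb_dev : |(∑ i, b i) / Fintype.card ι - (1 / (n : ℝ)) * ∑ t, b (J t)| ≤ D) :
    2 * α - (1 + α) * n / Fintype.card ι ≤ 2 * D := by
  classical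
  have hN : (0 : ℝ) < Fintype.card ι := by exact_mod_cast Fintype.card_pos
  have hn' : (0 : ℝ) < n := by exact_mod_cast hn
  have h1 : α ≤ (1 / (n : ℝ)) * ∑ t, b (J t) - (1 / (n : ℝ)) * ∑ t, a (J t) := by
    rw [← mul_sub, ← Finset.sum_sub_distrib, one_div, ← div_eq_inv_mul, le_div_iff₀ hn']
    calc α * n = ∑ _t : Fin n, α := by simp [mul_comm]
      _ ≤ _ := Finset.sum_le_sum fun t _ => by linarith [hlow (J t) ⟨t, rfl⟩]
  have hcard : (((Finset.univ.image J).card : ℕ) : ℝ) ≤ n := by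
    exact_mod_cast (Finset.card_image_le.trans (by simp))
  have h2 : (∑ i, b i) / Fintype.card ι - (∑ i, a i) / Fintype.card ι
      ≤ -α + (1 + α) * n / Fintype.card ι := by
    rw [← sub_div, ← Finset.sum_sub_distrib, div_le_iff₀ hN, add_mul, div_mul_cancel₀ _ hN.ne']
    -- At most `n` points are hit by the sample; there `b - a ≤ 1 = -α + (1 + α)`, and elsewhere `b
    -- - a ≤ -α`.
    calc ∑ i, (b i - a i) ≤ ∑ i, (-α + if i ∈ Finset.univ.image J then 1 + α else 0) := by
          refine Finset.sum_le_sum fun i _ => ?_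
          split_ifs with hi
          · linarith [hb i]
          · have : i ∉ Set.range J := by simpa using hi
            linarith [hhigh i this]
      _ = -α * Fintype.card ι + (1 + α) * (Finset.univ.image J).card := by
          rw [Finset.sum_add_distrib, ← Finset.sum_filter]
          simp only [Finset.sum_const, Finset.card_univ, nsmul_eq_mul, Finset.filter_univ_mem]
          ring
      _ ≤ _ := by gcongr
  have := abs_le.1 ha_dev
  have := abs_le.1 hb_dev
  linarith

/-! ### Colourings, quantization and aggregation. -/

section Coloring

variable {X : Type*}

/-- `F` restricted to the points `x` can be coloured with colours from `κ` such that functions of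
the same colour are uniformly within `α` of each other on these points. -/
def HasColoring {ι : Type*} (F : Set (X → ℝ)) (x : ι → X) (α : ℝ) (κ : Type*) : Prop :=
  ∃ c : (X → ℝ) → κ, ∀ f ∈ F, ∀ g ∈ F, c f = c g → ∀ i, |f (x i) - g (x i)| ≤ α

/-- The index of the cell of `[0, 1]` of width `1 / b` containing `t`. -/
noncomputable def quantize (b : ℕ) (t : ℝ) : Fin (b + 1) :=
  ⟨min ⌊t * b⌋₊ b, by omega⟩

lemma quantize_le {b : ℕ} {t : ℝ} (ht : t ∈ Set.Icc (0 : ℝ) 1) :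
    ((quantize b t : ℕ) : ℝ) ≤ t * b :=
  (Nat.cast_le.2 (min_le_left _ _)).trans
    (Nat.floor_le (mul_nonneg ht.1 (Nat.cast_nonneg b)))

lemma lt_quantize_add_one {b : ℕ} {t : ℝ} (ht : t ∈ Set.Icc (0 : ℝ) 1) :
    t * b < (quantize b t : ℕ) + 1 := by
  have : min ⌊t * b⌋₊ b = ⌊t * b⌋₊ := min_eq_left (Nat.floor_le_of_le
    (mul_le_of_le_one_left (Nat.cast_nonneg b) ht.2))
  simp only [quantize, this]
  exact Nat.lt_floor_add_one _

lemma HasColoring.aggregate {ι : Type*} {k : ℕ} {F : Fin k → Set (X → ℝ)} {G : (Fin k → ℝ) → ℝ}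
    (hF_range : ∀ i, ∀ f ∈ F i, ∀ x, f x ∈ Set.Icc (0 : ℝ) 1)
    (hG_lip : LipschitzOnWith 1 G {v : Fin k → ℝ | ∀ i, v i ∈ Set.Icc (0 : ℝ) 1})
    {x : ι → X} {α : ℝ} (hα : 0 ≤ α) {κ : Type*} [Nonempty κ] (h : ∀ i, HasColoring (F i) x α κ) :
    HasColoring (aggregate G F) x α (Fin k → κ) := by
  classical
  choose c hc using h
  refine ⟨fun h => if hh : h ∈ _root_.aggregate G F then fun i => c i (hh.choose i)
    else fun _ => Classical.arbitrary κ, fun f hf g hg hfg t => ?_⟩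
  simp only [dif_pos hf, dif_pos hg] at hfg
  obtain ⟨hf1, hf2⟩ := hf.choose_spec
  obtain ⟨hg1, hg2⟩ := hg.choose_spec
  rw [congrFun hf2 (x t), congrFun hg2 (x t), ← Real.dist_eq]
  refine (hG_lip.dist_le_mul _ (fun i => hF_range i _ (hf1 i) _) _
    (fun i => hF_range i _ (hg1 i) _)).trans ?_
  rw [NNReal.coe_one, one_mul, dist_pi_le_iff hα]
  intro i
  rw [Real.dist_eq]
  exact hc i _ (hf1 i) _ (hg1 i) (congrFun hfg i) t

end Coloring

/-! ### From uniform convergence to bounded shattering and small colourings. -/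

section UniformConvergence

variable {X : Type*} [MeasurableSpace X]

/-- A class with `γ`-uniform convergence does not shatter large finite sets of points with gap
`α > γ`. -/
lemma UniformConvergenceAt.exists_card_lt {γ α : ℝ} (hγ : 0 < γ) (hα : γ < α) {F : Set (X → ℝ)}
    (hF_range : ∀ f ∈ F, ∀ x, f x ∈ Set.Icc (0 : ℝ) 1) (hF_meas : ∀ f ∈ F, Measurable f)
    (hF : UniformConvergenceAt γ F) :
    ∃ d : ℕ, ∀ (ι : Type) [Fintype ι] (x : ι → X) (u v : ι → ℝ), (∀ i, u i + α ≤ v i) →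
      (∀ e : ι → Bool, ∃ f ∈ F, ∀ i, if e i then f (x i) ≤ u i else v i ≤ f (x i)) →
      Fintype.card ι < d := by
  classical
  -- With this `ε` two deviations sum to at most `α + γ`, while `d` below makes the lower bound
  -- exceed `2 * α - (α - γ)`. Any `δ < 1` would do.
  obtain ⟨m, hm⟩ := hF ((α - γ) / 2) (by linarith) (1 / 2) (by norm_num)
  set n := m + 1 with hn
  obtain ⟨d, hd⟩ := exists_nat_gt ((1 + α) * n / (α - γ))
  refine ⟨d, fun ι _ x u v huv hsh => ?_⟩
  by_contra! hcard
  have hαγ : 0 < α - γ := by linarith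
  have hα0 : 0 < α := hγ.trans hα
  have hd0 : (0 : ℝ) < d := lt_of_le_of_lt (by positivity) hd
  have hN : (d : ℝ) ≤ Fintype.card ι := by exact_mod_cast hcard
  have : Nonempty ι := Fintype.card_pos_iff.1 (by exact_mod_cast hd0.trans_le hN)
  let _ : MeasurableSpace ι := ⊤
  set μ : Measure ι := (PMF.uniformOfFintype ι).toMeasure with hμ
  have hx : Measurable x := measurable_from_top
  have : IsProbabilityMeasure (μ.map x) := Measure.isProbabilityMeasure_map hx.aemeasurable
  have key := hm (μ.map x) this n (by omega)
  rw [← Measure.pi_map_pi (fun _ => hx.aemeasurable)] at key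
  have key2 := (Measure.le_map_apply (Measurable.aemeasurable (by fun_prop)) _).trans key
  -- Failure has outer probability below `1`, so some sample is good for all of `F` at once; the
  -- sign patterns can then be chosen depending on it.
  obtain ⟨J, hJ⟩ : ∃ J : Fin n → ι, (fun t => x (J t)) ∉ {S : Fin n → X | ∃ f ∈ F,
      γ + (α - γ) / 2 < |(∫ y, f y ∂(μ.map x)) - (1 / (n : ℝ)) * ∑ i, f (S i)|} := by
    by_contra! h
    refine absurd key2 (not_le.2 ?_)
    calc ENNReal.ofReal (1 / 2) < 1 := by norm_num
      _ = Measure.pi (fun _ : Fin n => μ) Set.univ := measure_univ.symm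
      _ ≤ _ := measure_mono fun J _ => h J
  have hint : ∀ f ∈ F, ∫ y, f y ∂(μ.map x) = (∑ i, f (x i)) / Fintype.card ι := by
    intro f hf
    rw [integral_map hx.aemeasurable (hF_meas f hf).aestronglyMeasurable, hμ, PMF.integral_eq_sum]
    simp [Finset.mul_sum, div_eq_inv_mul]
  simp only [Set.mem_ofPred_eq, not_exists, not_and, not_lt] at hJ
  obtain ⟨f, hf, hf'⟩ := hsh fun i => decide (i ∈ Set.range J)
  obtain ⟨g, hg, hg'⟩ := hsh fun i => decide (i ∉ Set.range J)
  have hfd := hJ f hf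
  have hgd := hJ g hg
  rw [hint f hf] at hfd
  rw [hint g hg] at hgd
  have := two_mul_sub_le_of_low_high (by omega) J (a := fun i => f (x i)) (b := fun i => g (x i))
    (by linarith : 0 ≤ α) (fun i => by linarith [(hF_range f hf (x i)).1, (hF_range g hg (x i)).2])
    (fun i hi => by
      have h1 := hf' i
      have h2 := hg' i
      rw [if_pos (by simpa using hi)] at h1
      rw [if_neg (by simpa using hi)] at h2
      linarith [huv i])
    (fun i hi => by
      have h1 := hf' i
      have h2 := hg' i
      rw [if_neg (by simpa using hi)] at h1
      rw [if_pos (by simpa using hi)] at h2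
      linarith [huv i]) hfd hgd
  have h3 : (1 + α) * n / Fintype.card ι < α - γ := by
    rw [div_lt_iff₀ (hd0.trans_le hN)]
    rw [div_lt_iff₀ hαγ] at hd
    nlinarith
  linarith

/-- A class with `γ`-uniform convergence has colourings of quasi-polynomial size at every scale
above `γ`. -/
lemma UniformConvergenceAt.exists_hasColoring {γ α : ℝ} (hγ : 0 < γ) (hα : γ < α)
    {F : Set (X → ℝ)} (hF_range : ∀ f ∈ F, ∀ x, f x ∈ Set.Icc (0 : ℝ) 1)
    (hF_meas : ∀ f ∈ F, Measurable f) (hF : UniformConvergenceAt γ F) {b : ℕ} (hb : 0 < b) :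
    ∃ d : ℕ, ∀ d' : ℕ, d ≤ d' → ∀ (ι : Type) [Fintype ι] (x : ι → X) (r : ℕ),
      (Fintype.card ι * (b + 1) ^ 2 + 1) ^ d' < 2 ^ r →
      HasColoring F x (α + 2 / b) (Fin r → Option (ι × Fin (b + 1))) := by
  classical
  obtain ⟨d, hd⟩ := hF.exists_card_lt hγ hα hF_range hF_meas
  refine ⟨d, fun d' hd' ι _ x r hr => ?_⟩
  have hb' : (0 : ℝ) < b := by exact_mod_cast hb
  -- The `+ 1` is the width of one cell: the top `(u + 1) / b` of the lower cell and the bottom `v /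
  -- b` of the upper one must still be `α` apart.
  set far : Fin (b + 1) → Fin (b + 1) → Prop := fun u v => (u : ℕ) + 1 + α * b ≤ (v : ℕ)
    with hfar_def
  have hfar : ∀ u, ¬ far u u := fun u h => by
    have : 0 < α * b := by have := hγ.trans hα; positivity
    simp only [hfar_def] at h
    linarith
  set W : Set (ι → Fin (b + 1)) := (fun f i => quantize b (f (x i))) '' F with hW
  have hcount : shatterCount far W < 2 ^ r := by
    refine (shatterCount_le W d' fun p hp => ?_).trans_lt (by simpa using hr)
    refine le_trans ?_ hd'
    have hp' : ∀ i : {i // p i ≠ none}, ∃ z : Fin (b + 1) × Fin (b + 1), p i = some z :=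
      fun i => Option.ne_none_iff_exists'.1 i.2
    choose z hz using hp'
    rw [Set.ncard_eq_toFinset_card', Set.toFinset_card]
    refine (hd {i // p i ≠ none} (fun i => x i) (fun i => ((z i).1 + 1 : ℝ) / b)
      (fun i => ((z i).2 : ℝ) / b) (fun i => ?_) fun e => ?_).le
    · have := hp.1 i _ _ (hz i)
      rw [le_div_iff₀ hb', add_mul, div_mul_cancel₀ _ hb'.ne']
      exact this
    · obtain ⟨_, ⟨f, hf, rfl⟩, h⟩ := hp.2 fun i => if hi : p i ≠ none then e ⟨i, hi⟩ else true
      refine ⟨f, hf, fun i => ?_⟩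
      have hi := h i _ _ (hz i)
      rw [dif_pos i.2] at hi
      split_ifs with hei
      · rw [if_pos hei] at hi
        rw [le_div_iff₀ hb', ← hi]
        exact (lt_quantize_add_one (hF_range f hf _)).le
      · rw [if_neg hei] at hi
        rw [div_le_iff₀ hb', ← hi]
        exact quantize_le (hF_range f hf _)
  obtain ⟨c, hc⟩ := exists_coloring_of_shatterCount_lt hfar r W hcount
  -- One cell is lost in the definition of `far` and one in rounding, hence `2 / b`.
  have hlt : ∀ f ∈ F, ∀ g ∈ F, c (fun i => quantize b (f (x i))) = c (fun i => quantize b (g (x i)))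
      → ∀ i, g (x i) - f (x i) ≤ α + 2 / b := by
    intro f hf g hg hfg i
    have h := hc _ ⟨f, hf, rfl⟩ _ ⟨g, hg, rfl⟩ hfg i
    simp only [hfar_def, not_le] at h
    have h1 := quantize_le (b := b) (hF_range f hf (x i))
    have h2 := lt_quantize_add_one (b := b) (hF_range g hg (x i))
    have : (g (x i) - f (x i)) * b ≤ (α + 2 / b) * b := by
      rw [add_mul, div_mul_cancel₀ _ hb'.ne']
      linarith
    exact le_of_mul_le_mul_right this hb'
  refine ⟨fun f => c fun i => quantize b (f (x i)), fun f hf g hg hfg i => ?_⟩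
  rw [abs_le]
  constructor
  · linarith [hlt f hf g hg hfg i]
  · exact hlt g hg f hf hfg.symm i

end UniformConvergence

/-! ### Hoeffding's bound for random signs and the union bound over colours. -/

section RandomSigns

lemma sum_exp_sign_le {n : ℕ} {a : Fin n → ℝ} (ha : ∀ i, |a i| ≤ 1) (l : ℝ) :
    ∑ e : Fin n → Bool, Real.exp (l * ∑ i, (if e i then a i else -a i))
      ≤ 2 ^ n * Real.exp (n * (l ^ 2 / 2)) := by
  have h1 : ∀ e : Fin n → Bool, Real.exp (l * ∑ i, (if e i then a i else -a i))
      = ∏ i, Real.exp (l * if e i then a i else -a i) := by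
    intro e
    rw [Finset.mul_sum, Real.exp_sum]
  simp_rw [h1]
  have h2 := Finset.prod_univ_sum (fun _ : Fin n => (Finset.univ : Finset Bool))
    (fun i c => Real.exp (l * if c then a i else -a i))
  rw [Fintype.piFinset_univ] at h2
  rw [← h2]
  calc ∏ i, ∑ c : Bool, Real.exp (l * if c then a i else -a i)
      ≤ ∏ _i : Fin n, (2 * Real.exp (l ^ 2 / 2)) := by
        refine Finset.prod_le_prod (fun i _ => Finset.sum_nonneg fun c _ => (Real.exp_pos _).le)
          fun i _ => ?_
        have h3 : ∑ c : Bool, Real.exp (l * if c then a i else -a i) = 2 * Real.cosh (l * a i) := by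
          rw [Real.cosh_eq]
          simp
          ring
        rw [h3]
        have h4 : (l * a i) ^ 2 ≤ l ^ 2 := by
          rw [mul_pow]
          exact mul_le_of_le_one_right (sq_nonneg l) ((sq_le_one_iff_abs_le_one _).2 (ha i))
        gcongr
        exact (Real.cosh_le_exp_half_sq _).trans (by gcongr)
    _ = _ := by
        rw [Finset.prod_const, Finset.card_univ, Fintype.card_fin, mul_pow, ← Real.exp_nat_mul]

lemma card_lt_sum_sign_le {n : ℕ} {a : Fin n → ℝ} (ha : ∀ i, |a i| ≤ 1) {η : ℝ} (hη : 0 ≤ η) :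
    ((Finset.univ.filter fun e : Fin n → Bool =>
      η * n < ∑ i, (if e i then a i else -a i)).card : ℝ) ≤ 2 ^ n * Real.exp (-(η ^ 2 * n / 2)) := by
  set A := Finset.univ.filter fun e : Fin n → Bool => η * n < ∑ i, (if e i then a i else -a i)
    with hA
  have h1 : A.card * Real.exp (η * (η * n)) ≤ 2 ^ n * Real.exp (n * (η ^ 2 / 2)) := by
    refine le_trans ?_ (sum_exp_sign_le ha η)
    rw [← nsmul_eq_mul]
    refine (Finset.card_nsmul_le_sum A _ _ fun e he => ?_).trans
      (Finset.sum_le_univ_sum_of_nonneg fun e => (Real.exp_pos _).le)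
    rw [hA, Finset.mem_filter] at he
    gcongr
    exact he.2.le
  rw [← le_div_iff₀ (Real.exp_pos _), mul_div_assoc, ← Real.exp_sub] at h1
  rwa [show (n : ℝ) * (η ^ 2 / 2) - η * (η * n) = -(η ^ 2 * n / 2) by ring] at h1

/-- Hoeffding's inequality for random signs. -/
lemma card_lt_abs_sum_sign_le {n : ℕ} {a : Fin n → ℝ} (ha : ∀ i, |a i| ≤ 1) {η : ℝ} (hη : 0 ≤ η) :
    ((Finset.univ.filter fun e : Fin n → Bool =>
      η * n < |∑ i, (if e i then a i else -a i)|).card : ℝ)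
      ≤ 2 * (2 ^ n * Real.exp (-(η ^ 2 * n / 2))) := by
  have h1 := card_lt_sum_sign_le ha hη
  have h2 := card_lt_sum_sign_le (a := fun i => -a i) (fun i => by simpa using ha i) hη
  have h3 : (Finset.univ.filter fun e : Fin n → Bool =>
      η * n < |∑ i, (if e i then a i else -a i)|) ⊆
      (Finset.univ.filter fun e : Fin n → Bool => η * n < ∑ i, (if e i then a i else -a i)) ∪
      (Finset.univ.filter fun e : Fin n → Bool => η * n < ∑ i, (if e i then -a i else - -a i)) := by
    intro e he
    simp only [Finset.mem_filter, Finset.mem_univ, true_and, Finset.mem_union, lt_abs] at he ⊢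
    refine he.imp_right fun h => h.trans_eq ?_
    rw [← Finset.sum_neg_distrib]
    exact Finset.sum_congr rfl fun i _ => by split_ifs <;> rfl
  have h4 : ((Finset.univ.filter fun e : Fin n → Bool =>
      η * n < |∑ i, (if e i then a i else -a i)|).card : ℝ) ≤
      (Finset.univ.filter fun e : Fin n → Bool => η * n < ∑ i, (if e i then a i else -a i)).card +
      (Finset.univ.filter fun e : Fin n → Bool =>
        η * n < ∑ i, (if e i then -a i else - -a i)).card := by
    exact_mod_cast (Finset.card_le_card h3).trans (Finset.card_union_le _ _)
  linarith

/-- The midpoint of infimum and supremum works; the factor `1 / 2` is what preserves the scale under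
symmetrization. -/
lemma exists_center {A : Set ℝ} (hA : A ⊆ Set.Icc 0 1) {α : ℝ}
    (h : ∀ a ∈ A, ∀ b ∈ A, |a - b| ≤ α) : ∃ m ∈ Set.Icc (0 : ℝ) 1, ∀ a ∈ A, |a - m| ≤ α / 2 := by
  rcases A.eq_empty_or_nonempty with rfl | hne
  · exact ⟨0, by simp, by simp⟩
  have hbb : BddBelow A := ⟨0, fun a ha => (hA ha).1⟩
  have hba : BddAbove A := ⟨1, fun a ha => (hA ha).2⟩
  have h0 : 0 ≤ sInf A := le_csInf hne fun a ha => (hA ha).1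
  have h1 : sSup A ≤ 1 := csSup_le hne fun a ha => (hA ha).2
  have h2 : sSup A ≤ sInf A + α := by
    refine csSup_le hne fun a ha => ?_
    rw [← sub_le_iff_le_add]
    refine le_csInf hne fun b hb => ?_
    linarith [(abs_le.1 (h a ha b hb)).2]
  have h3 : sInf A ≤ sSup A := Real.sInf_le_sSup A hbb hba
  refine ⟨(sInf A + sSup A) / 2, ⟨by linarith, by linarith⟩, fun a ha => ?_⟩
  have := csInf_le hbb ha
  have := le_csSup hba ha
  rw [abs_le]
  constructor <;> linarith

/-- A coloured class deviates by more than the scale of its colouring for few sign patterns only. -/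
lemma HasColoring.card_swap_le {X : Type*} {n : ℕ} {H : Set (X → ℝ)}
    (hH : ∀ h ∈ H, ∀ x, h x ∈ Set.Icc (0 : ℝ) 1) {S S' : Fin n → X} {α η : ℝ} (hη : 0 ≤ η)
    {κ : Type*} [Fintype κ] (hc : HasColoring H (Sum.elim S S') α κ) :
    ({e : Fin n → Bool | ∃ h ∈ H, (α + η) * n < |∑ i, h (if e i then S i else S' i)
        - ∑ i, h (if e i then S' i else S i)|}.ncard : ℝ)
      ≤ Fintype.card κ * (2 * (2 ^ n * Real.exp (-(η ^ 2 * n / 2)))) := by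
  classical
  obtain ⟨c, hc⟩ := hc
  have hm : ∀ (j : κ) (z : Fin n ⊕ Fin n), ∃ m ∈ Set.Icc (0 : ℝ) 1,
      ∀ h ∈ H, c h = j → |h (Sum.elim S S' z) - m| ≤ α / 2 := by
    intro j z
    obtain ⟨m, hm, hm'⟩ := exists_center
      (A := (fun h : X → ℝ => h (Sum.elim S S' z)) '' {h ∈ H | c h = j}) (α := α)
      (by rintro _ ⟨h, hh, rfl⟩; exact hH h hh.1 _)
      (by
        rintro _ ⟨h, hh, rfl⟩ _ ⟨g, hg, rfl⟩
        exact hc h hh.1 g hg.1 (hh.2.trans hg.2.symm) z)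
    exact ⟨m, hm, fun h hh hj => hm' _ ⟨h, ⟨hh, hj⟩, rfl⟩⟩
  choose m hm hm' using hm
  -- Swapping the `i`-th pair of sample points only changes the sign of this difference of centres.
  let a : κ → Fin n → ℝ := fun j i => m j (Sum.inl i) - m j (Sum.inr i)
  have ha : ∀ j i, |a j i| ≤ 1 := by
    intro j i
    have h1 := hm j (Sum.inl i)
    have h2 := hm j (Sum.inr i)
    rw [abs_le]
    constructor <;> simp only [a] <;> linarith [h1.1, h1.2, h2.1, h2.2]
  have hsub : {e : Fin n → Bool | ∃ h ∈ H, (α + η) * n < |∑ i, h (if e i then S i else S' i)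
        - ∑ i, h (if e i then S' i else S i)|} ⊆
      ((Finset.univ.biUnion fun j => Finset.univ.filter fun e : Fin n → Bool =>
        η * n < |∑ i, (if e i then a j i else -a j i)| : Finset (Fin n → Bool)) : Set _) := by
    rintro e ⟨h, hh, hlt⟩
    simp only [Finset.coe_biUnion, Finset.coe_univ, Set.mem_univ, Set.iUnion_true, Set.mem_iUnion,
      Finset.coe_filter, Finset.mem_univ, true_and]
    refine ⟨c h, ?_⟩
    change η * n < _
    -- Each coordinate costs `α / 2` for `S i` and `α / 2` for `S' i`.
    have hdiff : |(∑ i, h (if e i then S i else S' i) - ∑ i, h (if e i then S' i else S i))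
        - ∑ i, (if e i then a (c h) i else -a (c h) i)| ≤ α * n := by
      rw [← Finset.sum_sub_distrib, ← Finset.sum_sub_distrib]
      refine (Finset.abs_sum_le_sum_abs _ _).trans ?_
      calc _ ≤ ∑ _i : Fin n, α := Finset.sum_le_sum fun i _ => ?_
        _ = α * n := by simp [mul_comm]
      have h1 := abs_le.1 (hm' (c h) (Sum.inl i) h hh rfl)
      have h2 := abs_le.1 (hm' (c h) (Sum.inr i) h hh rfl)
      simp only [Sum.elim_inl, Sum.elim_inr] at h1 h2
      rw [abs_le]
      cases e i <;> constructor <;> simp [a] <;> linarith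
    have := abs_sub_abs_le_abs_sub
      (∑ i, h (if e i then S i else S' i) - ∑ i, h (if e i then S' i else S i))
      (∑ i, (if e i then a (c h) i else -a (c h) i))
    linarith
  calc _ ≤ ((∑ j : κ, (Finset.univ.filter fun e : Fin n → Bool =>
        η * n < |∑ i, (if e i then a j i else -a j i)|).card : ℕ) : ℝ) := by
        refine Nat.cast_le.2 ((Set.ncard_le_ncard hsub (Finset.finite_toSet _)).trans ?_)
        rw [Set.ncard_coe_finset]
        exact Finset.card_biUnion_le
    _ ≤ _ := by
        rw [Nat.cast_sum, ← nsmul_eq_mul]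
        exact Finset.sum_le_card_nsmul _ _ _ fun j _ => card_lt_abs_sum_sign_le (ha j) hη

end RandomSigns

/-! ### Ghost samples, coordinatewise swaps and symmetrization. -/

section Symmetrization

open ProbabilityTheory

variable {X : Type*} [MeasurableSpace X]

/-- A pair of samples is a sample of `n` pairs, and `q.prod q` is invariant under swapping a pair.
-/
lemma measurePreserving_swap_on (q : Measure X) [IsProbabilityMeasure q] {n : ℕ}
    (e : Fin n → Bool) :
    MeasurePreserving (fun P : (Fin n → X) × (Fin n → X) =>
      ((fun i => if e i then P.1 i else P.2 i), (fun i => if e i then P.2 i else P.1 i)))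
      ((Measure.pi fun _ => q).prod (Measure.pi fun _ => q))
      ((Measure.pi fun _ => q).prod (Measure.pi fun _ => q)) := by
  have h1 := measurePreserving_arrowProdEquivProdArrow X X (Fin n) (fun _ => q) (fun _ => q)
  have h2 : MeasurePreserving (fun (z : Fin n → X × X) i => if e i then z i else (z i).swap)
      (Measure.pi fun _ => q.prod q) (Measure.pi fun _ => q.prod q) := by
    refine measurePreserving_pi (f := fun i (z : X × X) => if e i then z else z.swap) _ _
      fun i => ?_
    cases e i
    · simpa using Measure.measurePreserving_swap
    · exact MeasurePreserving.id _
  convert h1.comp (h2.comp h1.symm) using 1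
  funext P
  refine Prod.ext (funext fun i => ?_) (funext fun i => ?_)
  · cases h : e i <;> simp [MeasurableEquiv.arrowProdEquivProdArrow, Equiv.arrowProdEquivProdArrow, h]
  · cases h : e i <;> simp [MeasurableEquiv.arrowProdEquivProdArrow, Equiv.arrowProdEquivProdArrow, h]

/-- If every orbit under a finite family of measure preserving maps meets `B` at most `K` times,
then `B` has measure at most `K` divided by the size of the family. -/
lemma card_mul_measure_le_of_measurePreserving {Ω E : Type*} [MeasurableSpace Ω] [Fintype E]
    {μ : Measure Ω} [IsProbabilityMeasure μ] {T : E → Ω → Ω}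
    (hT : ∀ e, MeasurePreserving (T e) μ μ) {B : Set Ω} (hB : NullMeasurableSet B μ) {K : ℝ}
    (hK : ∀ ω, ({e | T e ω ∈ B}.ncard : ℝ) ≤ K) :
    (Fintype.card E : ENNReal) * μ B ≤ ENNReal.ofReal K := by
  classical
  have hB' : ∀ e, NullMeasurableSet (T e ⁻¹' B) μ :=
    fun e => hB.preimage (hT e).quasiMeasurePreserving
  calc (Fintype.card E : ENNReal) * μ B = ∑ e, μ (T e ⁻¹' B) := by
        rw [Finset.sum_congr rfl fun e _ => (hT e).measure_preimage hB]
        simp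
    _ = ∑ e, ∫⁻ ω, (T e ⁻¹' B).indicator 1 ω ∂μ :=
        Finset.sum_congr rfl fun e _ => (lintegral_indicator_one₀ (hB' e)).symm
    _ = ∫⁻ ω, ∑ e, (T e ⁻¹' B).indicator 1 ω ∂μ :=
        (lintegral_finsetSum' _ fun e _ => aemeasurable_one.indicator₀ (hB' e)).symm
    _ ≤ ∫⁻ _, ENNReal.ofReal K ∂μ := by
        refine lintegral_mono fun ω => ?_
        have : ∑ e, (T e ⁻¹' B).indicator (1 : Ω → ENNReal) ω
            = ENNReal.ofReal ({e | T e ω ∈ B}.ncard : ℝ) := by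
          rw [ENNReal.ofReal_natCast, Set.ncard_eq_toFinset_card']
          simp [Set.indicator_apply]
        rw [this]
        exact ENNReal.ofReal_le_ofReal (hK ω)
    _ = _ := by simp

/-- Chebyshev's inequality for the empirical sum of a `[0, 1]`-valued function. -/
lemma measure_abs_sum_sub_ge_le (q : Measure X) [IsProbabilityMeasure q] {h : X → ℝ}
    (hm : Measurable h) (hr : ∀ x, h x ∈ Set.Icc (0 : ℝ) 1) {n : ℕ} {ε : ℝ} (hε : 0 < ε)
    (hn : 0 < n) (hnε : 2 ≤ n * ε ^ 2) :
    Measure.pi (fun _ : Fin n => q) {S | n * (ε / 2) ≤ |∑ i, h (S i) - n * ∫ x, h x ∂q|}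
      ≤ 1 / 2 := by
  have hn' : (0 : ℝ) < n := by exact_mod_cast hn
  have hLp : MemLp h 2 q := MemLp.of_bound hm.aestronglyMeasurable 1
    (Filter.Eventually.of_forall fun x => by
      rw [Real.norm_eq_abs, abs_of_nonneg (hr x).1]; exact (hr x).2)
  have hvar : Var[h; q] ≤ 1 / 4 := by
    have := variance_le_sq_of_bounded (μ := q) (a := 0) (b := 1) (X := h)
      (Filter.Eventually.of_forall hr) hm.aemeasurable
    linarith
  have hmp : ∀ i : Fin n, MeasurePreserving (fun S : Fin n → X => S i)
      (Measure.pi fun _ => q) q := fun i => measurePreserving_eval (fun _ => q) i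
  have hLp' : MemLp (∑ i, fun S : Fin n → X => h (S i)) 2 (Measure.pi fun _ => q) :=
    memLp_finsetSum' _ fun i _ => hLp.comp_measurePreserving (hmp i)
  have hV : Var[∑ i, fun S : Fin n → X => h (S i); Measure.pi fun _ => q] ≤ n / 4 := by
    rw [variance_sum_pi (X := fun _ : Fin n => h) fun _ => hLp]
    simp only [Finset.sum_const, Finset.card_univ, Fintype.card_fin, nsmul_eq_mul]
    nlinarith
  have hE : ∫ S, (∑ i, fun S : Fin n → X => h (S i)) S ∂(Measure.pi fun _ => q)
      = n * ∫ x, h x ∂q := by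
    simp only [Finset.sum_apply]
    rw [integral_finsetSum (f := fun (i : Fin n) (S : Fin n → X) => h (S i)) _ fun i _ =>
      ((hmp i).integrable_comp hm.aestronglyMeasurable).2 (hLp.integrable (by norm_num))]
    have : ∀ i : Fin n, ∫ S : Fin n → X, h (S i) ∂(Measure.pi fun _ => q) = ∫ x, h x ∂q := by
      intro i
      rw [← (hmp i).map_eq, integral_map (hmp i).measurable.aemeasurable]
      · rw [(hmp i).map_eq]
      · rw [(hmp i).map_eq]; exact hm.aestronglyMeasurable
    simp [this]
  have hcheb := meas_ge_le_variance_div_sq hLp' (c := n * (ε / 2)) (by positivity)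
  rw [hE] at hcheb
  simp only [Finset.sum_apply] at hcheb
  refine hcheb.trans ?_
  rw [show (1 / 2 : ENNReal) = ENNReal.ofReal (1 / 2) by
    rw [ENNReal.ofReal_div_of_pos (by norm_num)]; simp]
  refine ENNReal.ofReal_le_ofReal ?_
  -- The variance `n / 4` over `(n * (ε / 2)) ^ 2` is `1 / (n * ε ^ 2)`, at most `1 / 2`.
  rw [div_le_iff₀ (by positivity)]
  nlinarith

/-- Symmetrization: the deviation from the mean is controlled by the deviation between two
independent samples. -/
lemma measure_deviation_le_two_mul (q : Measure X) [IsProbabilityMeasure q] {H : Set (X → ℝ)}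
    (hm : ∀ h ∈ H, Measurable h) (hr : ∀ h ∈ H, ∀ x, h x ∈ Set.Icc (0 : ℝ) 1) {n : ℕ} {γ ε : ℝ}
    (hε : 0 < ε) (hn : 0 < n) (hnε : 2 ≤ n * ε ^ 2) :
    Measure.pi (fun _ : Fin n => q)
        {S | ∃ h ∈ H, γ + ε < |(∫ x, h x ∂q) - (1 / (n : ℝ)) * ∑ i, h (S i)|}
      ≤ 2 * ((Measure.pi fun _ : Fin n => q).prod (Measure.pi fun _ : Fin n => q))
        {P | ∃ h ∈ H, (γ + ε / 2) * n < |∑ i, h (P.1 i) - ∑ i, h (P.2 i)|} := by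
  have hn' : (0 : ℝ) < n := by exact_mod_cast hn
  set μ := Measure.pi fun _ : Fin n => q with hμ
  set B := {P : (Fin n → X) × (Fin n → X) |
    ∃ h ∈ H, (γ + ε / 2) * n < |∑ i, h (P.1 i) - ∑ i, h (P.2 i)|} with hB
  -- Passing to a measurable hull of the same measure allows integration over sections.
  set B' := toMeasurable (μ.prod μ) B with hB'
  have hB'm : MeasurableSet B' := measurableSet_toMeasurable _ _
  rw [← measure_toMeasurable B, ← hB', Measure.prod_apply hB'm]
  -- For a fixed `h` witnessing the deviation of `S`, half of the ghost samples `S'` have mean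
  -- within `ε / 2` of the true one. The section over `S` thus has measure at least `1 / 2`, and
  -- Markov's inequality gives the factor `2`.
  have hsub : {S | ∃ h ∈ H, γ + ε < |(∫ x, h x ∂q) - (1 / (n : ℝ)) * ∑ i, h (S i)|} ⊆
      {S | 1 / 2 ≤ μ (Prod.mk S ⁻¹' B')} := by
    rintro S ⟨h, hh, hS⟩
    have hcheb := measure_abs_sum_sub_ge_le q (hm h hh) (hr h hh) hε hn hnε
    rw [← hμ] at hcheb
    have hmeas : MeasurableSet {S : Fin n → X | n * (ε / 2) ≤ |∑ i, h (S i) - n * ∫ x, h x ∂q|} := by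
      have := hm h hh
      exact measurableSet_le measurable_const (by fun_prop)
    have hcompl : 1 / 2 ≤ μ {S | n * (ε / 2) ≤ |∑ i, h (S i) - n * ∫ x, h x ∂q|}ᶜ := by
      rw [prob_compl_eq_one_sub hmeas]
      refine le_trans ?_ (tsub_le_tsub_left hcheb 1)
      rw [one_div, ENNReal.one_sub_inv_two]
    refine hcompl.trans (measure_mono fun S' hS' => subset_toMeasurable _ _ ⟨h, hh, ?_⟩)
    simp only [Set.mem_compl_iff, Set.mem_ofPred_eq, not_le] at hS'
    have h1 : (γ + ε) * n < |n * (∫ x, h x ∂q) - ∑ i, h (S i)| := by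
      have : n * (∫ x, h x ∂q) - ∑ i, h (S i)
          = ((∫ x, h x ∂q) - (1 / (n : ℝ)) * ∑ i, h (S i)) * n := by
        field_simp
      rw [this, abs_mul, abs_of_pos hn']
      gcongr
    have h2 := abs_sub_le (n * ∫ x, h x ∂q) (∑ i, h (S' i)) (∑ i, h (S i))
    rw [abs_sub_comm (n * ∫ x, h x ∂q) (∑ i, h (S' i)),
      abs_sub_comm (∑ i, h (S' i)) (∑ i, h (S i))] at h2
    change (γ + ε / 2) * n < |∑ i, h (S i) - ∑ i, h (S' i)|
    linarith
  have hmk := mul_meas_ge_le_lintegral (μ := μ) (measurable_measure_prodMk_left (ν := μ) hB'm) (1 / 2)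
  calc _ ≤ μ {S | 1 / 2 ≤ μ (Prod.mk S ⁻¹' B')} := measure_mono hsub
    _ = 2 * (1 / 2 * μ {S | 1 / 2 ≤ μ (Prod.mk S ⁻¹' B')}) := by
        rw [← mul_assoc, one_div, ENNReal.mul_inv_cancel (by norm_num) (by norm_num), one_mul]
    _ ≤ _ := by gcongr

end Symmetrization

/-! ### Asymptotics of the number of colours and assembly. -/

section Aggregate

open Filter

/-- A power of a quasi-polynomial colouring number is beaten by an exponential. -/
lemma eventually_quasipoly_mul_exp_le (d k b : ℕ) {c δ : ℝ} (hc : 0 < c) (hδ : 0 < δ) :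
    ∀ᶠ n : ℕ in atTop, (((((n + n) * (b + 1) + 1) ^
        (Nat.log 2 (((n + n) * (b + 1) ^ 2 + 1) ^ d) + 1)) ^ k : ℕ) : ℝ)
      * (2 * Real.exp (-(c * n))) ≤ δ := by
  -- Both bases are at most `C * n`, so with `y = log (C * n)` the logarithm of the number of
  -- colours is `O(y ^ 2 + y)`.
  set C : ℕ := 2 * (b + 1) ^ 2 + 1 with hC
  have hC0 : (0 : ℝ) < C := by positivity
  have hx : Tendsto (fun n : ℕ => (C : ℝ) * n) atTop atTop :=
    tendsto_natCast_atTop_atTop.const_mul_atTop hC0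
  have hl2 : 0 < Real.log 2 := Real.log_pos (by norm_num)
  -- The coefficients make the `y ^ 2` and `y` terms at most `c / 4 * n` each, leaving half of the
  -- exponential decay.
  have hcoef : 0 < c / C / 4 / ((k + 1) * (d + 1) / Real.log 2) := by positivity
  have hcoef' : 0 < c / C / 4 / (k + 1) := by positivity
  have e1 := hx.eventually ((Real.isLittleO_pow_log_id_atTop (n := 2)).def hcoef)
  have e2 := hx.eventually ((Real.isLittleO_pow_log_id_atTop (n := 1)).def hcoef')
  have e3 : ∀ᶠ n : ℕ in atTop, 2 * Real.exp (-(c / 2 * n)) ≤ δ := by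
    have : Tendsto (fun n : ℕ => 2 * Real.exp (-(c / 2 * n))) atTop (nhds (2 * 0)) :=
      (Real.tendsto_exp_neg_atTop_nhds_zero.comp
        (tendsto_natCast_atTop_atTop.const_mul_atTop (half_pos hc))).const_mul 2
    rw [mul_zero] at this
    exact this.eventually_le_const hδ
  filter_upwards [e1, e2, e3, eventually_ge_atTop 1] with n h1 h2 h3 hn
  set y := Real.log (C * n) with hy
  have hn1 : (1 : ℝ) ≤ n := by exact_mod_cast hn
  have hCn : (1 : ℝ) ≤ C * n := by
    have : (1 : ℝ) ≤ C := by rw [hC]; push_cast; nlinarith [sq_nonneg ((b : ℝ) + 1)]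
    nlinarith
  have hy0 : 0 ≤ y := Real.log_nonneg hCn
  simp only [id, Real.norm_eq_abs, pow_one] at h1 h2
  rw [abs_of_nonneg (sq_nonneg _), abs_of_nonneg (by positivity)] at h1
  rw [abs_of_nonneg hy0, abs_of_nonneg (by positivity)] at h2
  have b1 : (n + n) * (b + 1) + 1 ≤ C * n := by
    rw [hC]
    nlinarith [Nat.zero_le (n * b), Nat.zero_le (n * b * b)]
  have b2 : (n + n) * (b + 1) ^ 2 + 1 ≤ C * n := by
    rw [hC]
    nlinarith
  set r := Nat.log 2 (((n + n) * (b + 1) ^ 2 + 1) ^ d) + 1 with hr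
  have hr' : (r : ℝ) ≤ d * y / Real.log 2 + 1 := by
    rw [hr, Nat.cast_add, Nat.cast_one]
    gcongr
    rw [le_div_iff₀ hl2, ← Real.log_pow, hy, ← Real.log_pow]
    refine Real.log_le_log (by positivity) ?_
    exact_mod_cast (Nat.pow_log_le_self 2 (by positivity)).trans (Nat.pow_le_pow_left b2 d)
  have hbase : (((((n + n) * (b + 1) + 1) ^ r) ^ k : ℕ) : ℝ) ≤ Real.exp (k * (r * y)) := by
    calc (((((n + n) * (b + 1) + 1) ^ r) ^ k : ℕ) : ℝ) ≤ (((C * n) ^ r) ^ k : ℕ) := by gcongr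
      _ = ((C * n : ℝ) ^ r) ^ k := by push_cast; rfl
      _ = _ := by
        rw [hy, Real.exp_nat_mul, Real.exp_nat_mul, Real.exp_log (by linarith)]
  have hexp : k * (r * y) ≤ c / 2 * n := by
    have t1 : (k : ℝ) * (r * y) ≤ (k + 1) * (((d + 1) * y / Real.log 2 + 1) * y) := by
      gcongr
      · linarith
      · refine hr'.trans ?_
        gcongr
        linarith
    have t2 : (k + 1) * ((d + 1) / Real.log 2) * y ^ 2 ≤ c / 4 * n := by
      have hpos : (0 : ℝ) < (k + 1) * ((d + 1) / Real.log 2) := by positivity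
      rw [← le_div_iff₀' hpos]
      refine h1.trans (le_of_eq ?_)
      field_simp
    have t3 : (k + 1) * y ≤ c / 4 * n := by
      rw [← le_div_iff₀' (by positivity)]
      refine h2.trans (le_of_eq ?_)
      field_simp
    calc _ ≤ _ := t1
      _ = (k + 1) * ((d + 1) / Real.log 2) * y ^ 2 + (k + 1) * y := by ring
      _ ≤ _ := by linarith
  calc _ ≤ Real.exp (c / 2 * n) * (2 * Real.exp (-(c * n))) := by
        gcongr
        exact hbase.trans (Real.exp_le_exp.2 hexp)
    _ = 2 * Real.exp (-(c / 2 * n)) := by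
        rw [mul_left_comm, ← Real.exp_add]
        congr 2
        ring
    _ ≤ δ := h3

/-- `G` is controlled only on the cube, so the composition goes through the subtype. -/
lemma measurable_of_mem_aggregate {X : Type*} [MeasurableSpace X] {k : ℕ}
    {F : Fin k → Set (X → ℝ)} (hF_range : ∀ i, ∀ f ∈ F i, ∀ x, f x ∈ Set.Icc (0 : ℝ) 1)
    (hF_meas : ∀ i, ∀ f ∈ F i, Measurable f) {G : (Fin k → ℝ) → ℝ}
    (hG : ContinuousOn G {v : Fin k → ℝ | ∀ i, v i ∈ Set.Icc (0 : ℝ) 1}) {h : X → ℝ}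
    (hh : h ∈ aggregate G F) : Measurable h := by
  obtain ⟨f, hf, rfl⟩ := hh
  exact (continuousOn_iff_continuous_domRestrict.1 hG).measurable.comp
    (g := Set.domRestrict {v : Fin k → ℝ | ∀ i, v i ∈ Set.Icc (0 : ℝ) 1} G)
    ((measurable_pi_lambda _ fun i => hF_meas i _ (hf i)).subtype_mk
      (h := fun x i => hF_range i _ (hf i) x))

lemma HasColoring.mono {X ι κ : Type*} {F : Set (X → ℝ)} {x : ι → X} {α β : ℝ} (hαβ : α ≤ β)
    (h : HasColoring F x α κ) : HasColoring F x β κ :=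
  h.imp fun _ hc f hf g hg hfg i => (hc f hf g hg hfg i).trans hαβ

/-- Uniform convergence for a class with small colourings on double samples. -/
lemma measure_deviation_le_of_hasColoring {X : Type*} [MeasurableSpace X] (q : Measure X)
    [IsProbabilityMeasure q] {H : Set (X → ℝ)} (hm : ∀ h ∈ H, Measurable h)
    (hr : ∀ h ∈ H, ∀ x, h x ∈ Set.Icc (0 : ℝ) 1) (hH : DoubleSampleMeasurable H) {n : ℕ} {γ ε : ℝ}
    (hε : 0 < ε) (hn : 0 < n) (hnε : 2 ≤ n * ε ^ 2) {κ : Type*} [Fintype κ]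
    (hc : ∀ S S' : Fin n → X, HasColoring H (Sum.elim S S') (γ + ε / 4) κ) :
    Measure.pi (fun _ : Fin n => q)
        {S | ∃ h ∈ H, γ + ε < |(∫ x, h x ∂q) - (1 / (n : ℝ)) * ∑ i, h (S i)|}
      ≤ ENNReal.ofReal (2 * (Fintype.card κ * (2 * Real.exp (-((ε / 4) ^ 2 / 2 * n))))) := by
  refine (measure_deviation_le_two_mul q hm hr hε hn hnε).trans ?_
  rw [ENNReal.ofReal_mul (by norm_num), ENNReal.ofReal_ofNat]
  gcongr
  -- Averaging over all `2 ^ n` swaps turns the count of bad sign patterns into a measure bound; the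
  -- measurability convention on `H` enters here.
  have key := card_mul_measure_le_of_measurePreserving (fun e => measurePreserving_swap_on q e)
    (hH q inferInstance n ((γ + ε / 2) * n)) (fun P => by
      have := (hc P.1 P.2).card_swap_le hr (η := ε / 4) (by positivity)
      rw [show γ + ε / 4 + ε / 4 = γ + ε / 2 by ring] at this
      exact this)
  rw [show (Fintype.card κ : ℝ) * (2 * (2 ^ n * Real.exp (-((ε / 4) ^ 2 * n / 2))))
      = 2 ^ n * (Fintype.card κ * (2 * Real.exp (-((ε / 4) ^ 2 / 2 * n)))) by
        rw [show (ε / 4) ^ 2 * n / 2 = (ε / 4) ^ 2 / 2 * n by ring]; ring,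
    ENNReal.ofReal_mul (by positivity), ENNReal.ofReal_pow (by norm_num), ENNReal.ofReal_ofNat,
    Fintype.card_fun, Fintype.card_bool, Fintype.card_fin, Nat.cast_pow, Nat.cast_ofNat] at key
  exact (ENNReal.mul_le_mul_iff_right (by simp) (by simp)).1 key

end Aggregate

theorem mainTheorem7 {X : Type*} [MeasurableSpace X] {k : ℕ} (γ : ℝ) (hγ : 0 < γ)
    (F : Fin k → Set (X → ℝ))
    (hF_range : ∀ i, ∀ f ∈ F i, ∀ x, f x ∈ Set.Icc (0 : ℝ) 1)
    (hF_meas : ∀ i, ∀ f ∈ F i, Measurable f)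
    (G : (Fin k → ℝ) → ℝ)
    (hG_maps : ∀ v, (∀ i, v i ∈ Set.Icc (0 : ℝ) 1) → G v ∈ Set.Icc (0 : ℝ) 1)
    (hG_lip : LipschitzOnWith 1 G {v : Fin k → ℝ | ∀ i, v i ∈ Set.Icc (0 : ℝ) 1})
    (hGF_meas : DoubleSampleMeasurable (aggregate G F))
    (hUC : ∀ i, UniformConvergenceAt γ (F i)) :
    UniformConvergenceAt γ (aggregate G F) := by
  intro ε hε δ hδ
  -- Of the slack `ε / 4`, half goes to the shattering gap above `γ` and half to the quantization
  -- error `2 / b`.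
  obtain ⟨b, hb⟩ := exists_nat_gt (16 / ε)
  have hb0 : (0 : ℝ) < b := lt_trans (by positivity) hb
  have hscale : γ + ε / 8 + 2 / b ≤ γ + ε / 4 := by
    have : 2 / (b : ℝ) ≤ ε / 8 := by
      rw [div_lt_iff₀ hε] at hb
      rw [div_le_iff₀ hb0]
      linarith
    linarith
  choose d hd using fun i => (hUC i).exists_hasColoring hγ (by linarith : γ < γ + ε / 8)
    (hF_range i) (hF_meas i) (b := b) (by exact_mod_cast hb0)
  -- A common exponent gives all `F i` the same transcript length `r`.
  set D := Finset.univ.sup d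
  obtain ⟨m, hm⟩ := Filter.eventually_atTop.1
    ((eventually_quasipoly_mul_exp_le D k b (c := (ε / 4) ^ 2 / 2) (by positivity)
      (half_pos hδ)).and (Filter.eventually_gt_atTop 0))
  obtain ⟨m', hm'⟩ := exists_nat_gt (2 / ε ^ 2)
  refine ⟨max m m', fun q hq n hn => ?_⟩
  obtain ⟨hsmall, hn0⟩ := hm n (le_of_max_le_left hn)
  have hnε : 2 ≤ n * ε ^ 2 := by
    rw [← div_le_iff₀ (by positivity)]
    exact hm'.le.trans (by exact_mod_cast le_of_max_le_right hn)
  set r := Nat.log 2 (((n + n) * (b + 1) ^ 2 + 1) ^ D) + 1 with hr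
  have hcol : ∀ S S' : Fin n → X, HasColoring (aggregate G F) (Sum.elim S S') (γ + ε / 4)
      (Fin k → Fin r → Option ((Fin n ⊕ Fin n) × Fin (b + 1))) := by
    intro S S'
    refine HasColoring.mono hscale (HasColoring.aggregate hF_range hG_lip (by positivity)
      fun i => hd i D (Finset.le_sup (Finset.mem_univ i)) _ _ r ?_)
    rw [Fintype.card_sum, Fintype.card_fin]
    exact Nat.lt_pow_succ_log_self (by norm_num) _
  refine (measure_deviation_le_of_hasColoring q
    (fun h hh => measurable_of_mem_aggregate hF_range hF_meas hG_lip.continuousOn hh)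
    ?_ hGF_meas hε hn0 hnε hcol).trans (ENNReal.ofReal_le_ofReal ?_)
  · rintro _ ⟨f, hf, rfl⟩ x
    exact hG_maps _ fun i => hF_range i _ (hf i) x
  · have hcard : Fintype.card (Fin k → Fin r → Option ((Fin n ⊕ Fin n) × Fin (b + 1)))
        = (((n + n) * (b + 1) + 1) ^ r) ^ k := by
      simp
    rw [hcard]
    linarith
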